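/- Let $k$ be a field of characteristic $p>0$ and let $G$ be a group of type $\Phi$ over $k$, i.e. every $kG$-module whose restriction to each finite subgroup $F\le G$ has finite projective dimension over $kF$ has itself finite projective dimension over $kG$. Let $\operatorname{findim}(kG)=\sup\{\operatorname{projdim}_{kG}M : \operatorname{projdim}_{kG}M<\infty\}$. A complete resolution of a $kG$-module $M$ consists of a projective resolution $P_*\to M$, an exact complex $Q_*=(Q_i)_{i\in\mathbb Z}$ of projective $kG$-modules such that $\operatorname{Hom}_{kG}(Q_*,P)$ is exact for every projective $kG$-module $P$, and a chain map $\tau:Q_*\to P_*$ (where $P_i=0$ for $i<0$) that is an isomorphism in all degrees $\ge n$, for some integer $n\ge 0$ called the coincidence index. Given complete resolutions $(P_*,Q_*,\tau,n)$ of $M$ and $(P'_*,Q'_*,\tau',n')$ of $N$, a chain map $F:Q_*\to Q'_*$ is said to be induced by a homomorphism $f:M\to N$ if there is a chain map $\varphi:P_*\to P'_*$ lifting $f$ such that $\tau' F$ and $\varphi\tau$ are chain homotopic. Then: 1. Every $kG$-module has a complete resolution with coincidence index at most $\operatorname{findim}(kG)$. 2. Any two complete resolutions of the same $kG$-module $M$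 are chain homotopy equivalent; that is, there is a chain homotopy equivalence between the complexes $Q_*$ and $Q'_*$ which, together with its homotopy inverse, is induced by $\mathrm{id}_M$. 3. For every homomorphism $f:M\to N$ of $kG$-modules and all complete resolutions of $M$ and $N$ as above, there is a chain map $F:Q_*\to Q'_*$ induced by $f$, and any two such chain maps are chain homotopic. Moreover, for every chain map $\varphi:P_*\to P'_*$ lifting $f$, there is a chain map $F:Q_*\to Q'_*$ such that $\tau'F$ is chain homotopic to $\varphi\tau$ and $\tau'F=\varphi\tau$ in all degrees $\ge\max(n,n')$. -/

import Mathlib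

open CategoryTheory CategoryTheory.Limits

universe w u v

noncomputable section

/-- Restriction to a subgroup `F ≤ G` of a module over the group algebra `kG`. -/
def restrictToSubgroup (k : Type u) (G : Type v) [Field k] [Group G]
    (M : ModuleCat.{max u v} (MonoidAlgebra k G)) (F : Subgroup G) :
    ModuleCat.{max u v} (MonoidAlgebra k F) :=
  (ModuleCat.restrictScalars (MonoidAlgebra.mapDomainRingHom k F.subtype)).obj M

/-- A group `G` is of type `Φ` over `k` if every `kG`-module whose restriction to each finite
subgroup has finite projective dimension has itself finite projective dimension.
(The projective dimension of the zero module is `⊥`, which counts as finite.) -/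
def IsTypePhi (k : Type u) (G : Type v) [Field k] [Group G] : Prop :=
  ∀ M : ModuleCat.{max u v} (MonoidAlgebra k G),
    (∀ F : Subgroup G, Finite F → projectiveDimension (restrictToSubgroup k G M F) < ⊤) →
      projectiveDimension M < ⊤

/-- The finitistic dimension of `kG`: the supremum of the projective dimensions of the
`kG`-modules of finite projective dimension. -/
def findim (k : Type u) (G : Type v) [Field k] [Group G] : WithBot ℕ∞ :=
  ⨆ (M : ModuleCat.{max u v} (MonoidAlgebra k G)) (_ : projectiveDimension M < ⊤),
    projectiveDimension M

/-- The inclusion of the indices `0, 1, 2, …` into `ℤ`, for complexes with differentials of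
degree `-1`. Extending along it puts zero objects in the negative degrees. -/
def natToInt : (ComplexShape.down ℕ).Embedding (ComplexShape.down ℤ) :=
  ComplexShape.Embedding.mk' _ _ (fun n => (n : ℤ))
    (fun _ _ h => by simpa using h)
    (by intro i j; simp only [ComplexShape.down_Rel]; omega)

variable {R : Type u} [Ring R]

/-- Exactness of the complex of abelian groups `Hom_R(Q_*, P)`. -/
def HomExact (Q : ChainComplex (ModuleCat.{w} R) ℤ) (P : ModuleCat.{w} R) : Prop :=
  ∀ (i : ℤ) (f : Q.X i ⟶ P), Q.d (i + 1) i ≫ f = 0 →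
    ∃ g : Q.X (i - 1) ⟶ P, Q.d i (i - 1) ≫ g = f

/-- A complete resolution of the module `M`. -/
structure CompleteResolution (M : ModuleCat.{w} R) where
  /-- the projective resolution `P_* → M` -/
  P : ProjectiveResolution M
  /-- the doubly infinite complex `Q_*` -/
  Q : ChainComplex (ModuleCat.{w} R) ℤ
  /-- the vertical maps from `Q_*` to `P_*` (extended by zero to the negative degrees) -/
  τ : Q ⟶ P.complex.extend natToInt
  /-- the coincidence index -/
  n : ℕ
  projective : ∀ i, Projective (Q.X i)
  acyclic : Q.Acyclic
  homExact : ∀ X : ModuleCat.{w} R, Projective X → HomExact Q X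
  /-- `Q_*` and `P_*` coincide, via the vertical maps, in degrees `≥ n` -/
  isIso : ∀ i : ℤ, (n : ℤ) ≤ i → IsIso (τ.f i)

namespace CompleteResolution

variable {M N : ModuleCat.{w} R} (C : CompleteResolution M) (D : CompleteResolution N)

/-- `φ` is a map between the projective resolutions that lifts `f : M ⟶ N`. -/
def IsLift (f : M ⟶ N) (φ : C.P.complex ⟶ D.P.complex) : Prop :=
  φ ≫ D.P.π = C.P.π ≫ (ChainComplex.single₀ (ModuleCat.{w} R)).map f

/-- The composite `Q_* → P_* → P'_*` of the vertical maps of `C` with `φ`. -/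
def viaLeft (φ : C.P.complex ⟶ D.P.complex) : C.Q ⟶ D.P.complex.extend natToInt :=
  C.τ ≫ HomologicalComplex.extendMap φ natToInt

/-- The chain map `F : Q_* → Q'_*` is induced by `f`: for some lift `φ : P_* → P'_*` of `f`
the square formed by `F`, `φ` and the vertical maps commutes up to chain homotopy. -/
def IsInducedBy (f : M ⟶ N) (F : C.Q ⟶ D.Q) : Prop :=
  ∃ φ : C.P.complex ⟶ D.P.complex, IsLift C D f φ ∧
    Nonempty (Homotopy (F ≫ D.τ) (viaLeft C D φ))

end CompleteResolution

end

/-! Comparison. The terms of `P'_*` and `Q'_*` are projective and `Hom(Q_*, -)` is exact on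
projectives, so a chain map or a homotopy from `Q_*` into either complex that is known in high
degrees can be continued downward one degree at a time. In high degrees `τ'` is invertible, so `φτ`
and homotopies into `P'_*` can be transported to `Q'_*` there and then continued. This gives parts 2
and 3 from the usual comparison of projective resolutions, without using type `Φ`
(`exists_hom_of_lift`, `nonempty_homotopy_zero_of_comp_τ`).

Existence. Consider the modules that are projective over every finite subgroup. By Higman's trace
criterion this class contains all projectives and all injectives and is closed under products; it is
also closed under cokernels of monomorphisms, since projectives over a finite group algebra are
injective. For type `Φ` it is exactly the class of modules of finite projective dimension, and a
product argument makes `findim` a finite number `d`. Hence injectives have projective dimension at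
most `d`; as the class is closed under cosyzygies, projectives have injective dimension at most `d`.

Embed `N` in an injective `I`. A `d`-th syzygy of `N` then embeds in one of `I`, which is
projective, and the cokernel is a `d`-th syzygy of `I/N`. Iterating gives a projective coresolution
of a `d`-th syzygy of `M`, which is spliced with the resolution above degree `d`. Finite injective
dimension of projectives makes the result Hom-exact. -/

noncomputable section

/-! ### Downward extension of chain maps and homotopies -/

/-- A family of data indexed by `ℤ`, compatible in degrees `≥ n`, can be changed in degrees `< n` so
as to be compatible everywhere, if compatible data always extend one degree down. -/
lemma exists_extend_downward {α : ℤ → Type*} (r : ∀ i, α (i + 1) → α i → Prop) (n : ℤ)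
    (f : ∀ i, α i) (hf : ∀ i, n ≤ i → r i (f (i + 1)) (f i))
    (step : ∀ i b a, r (i + 1) b a → ∃ c, r i a c) :
    ∃ F : ∀ i, α i, (∀ i, n ≤ i → F i = f i) ∧ ∀ i, r i (F (i + 1)) (F i) := by
  -- The compatibility hypothesis sits inside the existential so that `choose` yields a total
  -- operation on families, which can be iterated.
  have one_step : ∀ (m : ℤ) (g : ∀ i, α i), ∃ g' : ∀ i, α i,
      (∀ i, m + 1 ≤ i → r i (g (i + 1)) (g i)) →
        (∀ i, m + 1 ≤ i → g' i = g i) ∧ ∀ i, m ≤ i → r i (g' (i + 1)) (g' i) := by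
    intro m g
    by_cases hg : ∀ i, m + 1 ≤ i → r i (g (i + 1)) (g i)
    · obtain ⟨c, hc⟩ := step m _ _ (hg (m + 1) le_rfl)
      refine ⟨Function.update g m c, fun _ => ⟨fun i hi => ?_, fun i hi => ?_⟩⟩
      · exact Function.update_of_ne (by lia) _ _
      · rw [Function.update_of_ne (by lia : i + 1 ≠ m)]
        obtain rfl | hi' := eq_or_lt_of_le hi
        · simpa using hc
        · rw [Function.update_of_ne (by lia : i ≠ m)]
          exact hg i (by lia)
    · exact ⟨g, fun h => absurd h hg⟩
  choose next hnext using one_step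
  let s : ℕ → ∀ i, α i := fun j => Nat.rec f (fun j g => next (n - (j + 1 : ℕ)) g) j
  have hs : ∀ j : ℕ, ∀ i, n - j ≤ i → r i (s j (i + 1)) (s j i) := by
    intro j
    induction j with
    | zero => exact fun i hi => hf i (by simpa using hi)
    | succ j ih => exact (hnext _ (s j) fun i hi => ih i (by push_cast at hi; lia)).2
  have hs_succ : ∀ j : ℕ, ∀ i, n - j ≤ i → s (j + 1) i = s j i := fun j i hi =>
    (hnext _ (s j) fun i hi => hs j i (by push_cast at hi; lia)).1 i (by push_cast; lia)
  -- Diagonal choice: from stage `n - i` on, the value in degree `i` no longer changes.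
  refine ⟨fun i => s (n - i).toNat i, fun i hi => ?_, fun i => ?_⟩
  · have : (n - i).toNat = 0 := by lia
    simp only [this]
    rfl
  · have h := hs (n - i).toNat i (by lia)
    have h' : s (n - (i + 1)).toNat (i + 1) = s (n - i).toNat (i + 1) := by
      obtain hi | hi := lt_or_ge i n
      · have : (n - i).toNat = (n - (i + 1)).toNat + 1 := by lia
        rw [this, hs_succ _ _ (by lia)]
      · have h₁ : (n - (i + 1)).toNat = 0 := by lia
        have h₂ : (n - i).toNat = 0 := by lia
        rw [h₁, h₂]
    simp only [h']
    exact h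

section Extension

variable {R : Type u} [Ring R] {Q E : ChainComplex (ModuleCat.{w} R) ℤ}

lemma HomExact.exists_desc {X : ModuleCat.{w} R} (h : HomExact Q X) {k i j : ℤ} (hk : i + 1 = k)
    (hj : j + 1 = i) (f : Q.X i ⟶ X) (hf : Q.d k i ≫ f = 0) :
    ∃ g : Q.X j ⟶ X, Q.d i j ≫ g = f := by
  subst hk
  obtain rfl : j = i - 1 := by lia
  exact h i f hf

/-- If the square above commutes, then `a ≫ E.d` is killed by the incoming differential of `Q`,
hence factors through the outgoing one; the factor is the next component. Exactness of `E` plays no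
role. -/
lemma exists_hom_extending (hQ : ∀ i, HomExact Q (E.X i)) (n : ℤ) (f : ∀ i, Q.X i ⟶ E.X i)
    (hf : ∀ i, n ≤ i → f (i + 1) ≫ E.d (i + 1) i = Q.d (i + 1) i ≫ f i) :
    ∃ F : Q ⟶ E, ∀ i, n ≤ i → F.f i = f i := by
  obtain ⟨F, hF, hcomm⟩ := exists_extend_downward (α := fun i => (Q.X i ⟶ E.X i))
    (fun i b a => b ≫ E.d (i + 1) i = Q.d (i + 1) i ≫ a) n f hf (by
      intro i b a hab
      obtain ⟨c, hc⟩ := (hQ i).exists_desc (k := i + 1 + 1) rfl rfl (a ≫ E.d (i + 1) i)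
        (by rw [← Category.assoc, ← hab, Category.assoc, E.d_comp_d, comp_zero])
      exact ⟨c, hc.symm⟩)
  exact ⟨{ f := F, comm' := by rintro _ j rfl; exact hcomm j }, hF⟩

lemma nonempty_homotopy_zero_of_partial (hQ : ∀ i, HomExact Q (E.X i)) (F : Q ⟶ E) (n : ℤ)
    (h : ∀ i, Q.X i ⟶ E.X (i + 1))
    (hh : ∀ i, n ≤ i → F.f (i + 1) =
      Q.d (i + 1) i ≫ h i + h (i + 1) ≫ E.d (i + 1 + 1) (i + 1)) :
    Nonempty (Homotopy F 0) := by
  obtain ⟨H, -, hH⟩ := exists_extend_downward (α := fun i => (Q.X i ⟶ E.X (i + 1)))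
    (fun i b a => F.f (i + 1) = Q.d (i + 1) i ≫ a + b ≫ E.d (i + 1 + 1) (i + 1)) n h hh (by
      intro i b a hab
      obtain ⟨c, hc⟩ := (hQ (i + 1)).exists_desc (k := i + 1 + 1) (i := i + 1) (j := i) rfl rfl
        (F.f (i + 1) - a ≫ E.d (i + 1 + 1) (i + 1)) (by
          rw [Preadditive.comp_sub, ← F.comm, hab]
          simp)
      exact ⟨c, by rw [hc]; abel⟩)
  refine ⟨{
    hom := fun i j => if hij : i + 1 = j then H i ≫ (E.XIsoOfEq hij).hom else 0
    zero := fun i j hij => dif_neg hij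
    comm := fun j => ?_ }⟩
  obtain ⟨i, rfl⟩ : ∃ i, j = i + 1 := ⟨j - 1, by lia⟩
  rw [dNext_eq _ (show (ComplexShape.down ℤ).Rel (i + 1) i from rfl),
    prevD_eq _ (show (ComplexShape.down ℤ).Rel (i + 1 + 1) (i + 1) from rfl), hH i]
  simp [HomologicalComplex.XIsoOfEq]

end Extension

lemma CategoryTheory.ProjectiveResolution.projective_extend_X {R : Type u} [Ring R]
    {M : ModuleCat.{w} R} (P : ProjectiveResolution M) (i : ℤ) : Projective ((P.complex.extend natToInt).X i) := by
  by_cases h : ∃ n, natToInt.f n = i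
  · obtain ⟨n, hn⟩ := h
    exact Projective.of_iso (P.complex.extendXIso natToInt hn).symm inferInstance
  · exact Projective.of_iso (P.complex.isZero_extend_X natToInt i (by tauto)).isoZero.symm
      inferInstance

/-! ### Comparison of complete resolutions -/

namespace CompleteResolution

variable {R : Type u} [Ring R] {M N L : ModuleCat.{w} R} (C : CompleteResolution M)
  (D : CompleteResolution N) (B : CompleteResolution L)

instance : natToInt.IsRelIff where
  rel' i j h := by
    have h' : (j : ℤ) + 1 = i := h
    exact (by lia : j + 1 = i)

lemma exists_hom_of_lift (φ : C.P.complex ⟶ D.P.complex) :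
    ∃ F : C.Q ⟶ D.Q, Nonempty (Homotopy (F ≫ D.τ) (C.viaLeft D φ)) ∧
      ∀ i : ℤ, (C.n : ℤ) ≤ i → (D.n : ℤ) ≤ i → (F ≫ D.τ).f i = (C.viaLeft D φ).f i := by
  classical
  let f : ∀ i, C.Q.X i ⟶ D.Q.X i := fun i =>
    if h : (D.n : ℤ) ≤ i then
      have := D.isIso i h
      (C.viaLeft D φ).f i ≫ inv (D.τ.f i)
    else 0
  have hf : ∀ i, (D.n : ℤ) ≤ i → f i ≫ D.τ.f i = (C.viaLeft D φ).f i := by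
    intro i hi
    have := D.isIso i hi
    simp [f, hi]
  obtain ⟨F, hF⟩ := exists_hom_extending (fun i => C.homExact _ (D.projective i))
    (max C.n D.n) f (by
      intro i hi
      have hi' : (D.n : ℤ) ≤ i := le_trans (le_max_right _ _) hi
      have := D.isIso i hi'
      rw [← cancel_mono (D.τ.f i), Category.assoc, ← D.τ.comm, ← Category.assoc,
        hf _ (by lia), Category.assoc, hf _ hi', (C.viaLeft D φ).comm])
  have hF' : ∀ i : ℤ, (max C.n D.n : ℤ) ≤ i → (F ≫ D.τ).f i = (C.viaLeft D φ).f i := by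
    intro i hi
    rw [HomologicalComplex.comp_f, hF i hi, hf i (le_trans (le_max_right _ _) hi)]
  refine ⟨F, ?_, fun i h₁ h₂ => hF' i (max_le h₁ h₂)⟩
  -- The two maps agree in high degrees, so the zero homotopy serves there and is continued downward
  -- into the projective terms of `P'_*`.
  obtain ⟨H⟩ := nonempty_homotopy_zero_of_partial
    (fun i => C.homExact _ (D.P.projective_extend_X i)) (F ≫ D.τ - C.viaLeft D φ)
    (max C.n D.n) (fun _ => 0) (by
      intro i hi
      rw [HomologicalComplex.sub_f_apply, hF' _ (by lia)]
      simp)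
  exact ⟨(Homotopy.equivSubZero).symm H⟩

lemma exists_isInducedBy (f : M ⟶ N) : ∃ F : C.Q ⟶ D.Q, C.IsInducedBy D f F := by
  obtain ⟨F, hF, -⟩ := C.exists_hom_of_lift D (ProjectiveResolution.lift f C.P D.P)
  exact ⟨F, _, ProjectiveResolution.lift_commutes f C.P D.P, hF⟩

variable {C D B}

/-- Where `τ'` is invertible the null homotopy can be divided by it; Hom-exactness continues the
quotient to the remaining degrees. -/
lemma nonempty_homotopy_zero_of_comp_τ {F : C.Q ⟶ D.Q} (H : Homotopy (F ≫ D.τ) 0) :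
    Nonempty (Homotopy F 0) := by
  classical
  let h : ∀ i, C.Q.X i ⟶ D.Q.X (i + 1) := fun i =>
    if hi : (D.n : ℤ) ≤ i + 1 then
      have := D.isIso (i + 1) hi
      H.hom i (i + 1) ≫ inv (D.τ.f (i + 1))
    else 0
  have hh : ∀ i, (D.n : ℤ) ≤ i + 1 → h i ≫ D.τ.f (i + 1) = H.hom i (i + 1) := by
    intro i hi
    have := D.isIso (i + 1) hi
    simp [h, hi]
  refine nonempty_homotopy_zero_of_partial (fun i => C.homExact _ (D.projective i)) F D.n h ?_
  intro i hi
  have hi' : (D.n : ℤ) ≤ i + 1 := hi.trans (by simp)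
  have hi'' : (D.n : ℤ) ≤ i + 1 + 1 := hi'.trans (by simp)
  have := D.isIso (i + 1) hi'
  rw [← cancel_mono (D.τ.f (i + 1)), Preadditive.add_comp, Category.assoc, hh _ hi',
    Category.assoc, ← D.τ.comm, ← Category.assoc (h (i + 1)), hh _ hi'']
  have := H.comm (i + 1)
  rwa [dNext_eq _ (show (ComplexShape.down ℤ).Rel (i + 1) i from rfl),
    prevD_eq _ (show (ComplexShape.down ℤ).Rel (i + 1 + 1) (i + 1) from rfl),
    HomologicalComplex.zero_f_apply, add_zero] at this

lemma IsInducedBy.nonempty_homotopy {f : M ⟶ N} {F F' : C.Q ⟶ D.Q}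
    (hF : C.IsInducedBy D f F) (hF' : C.IsInducedBy D f F') : Nonempty (Homotopy F F') := by
  obtain ⟨φ, hφ, ⟨H⟩⟩ := hF
  obtain ⟨φ', hφ', ⟨H'⟩⟩ := hF'
  have K : Homotopy φ φ' := ProjectiveResolution.liftHomotopy f φ φ' hφ hφ'
  have K' : Homotopy (C.viaLeft D φ) (C.viaLeft D φ') := (K.extend natToInt).compLeft C.τ
  have H₀ : Homotopy ((F - F') ≫ D.τ) 0 :=
    (Homotopy.ofEq (Preadditive.sub_comp _ _ _)).trans
      (Homotopy.equivSubZero ((H.trans K').trans H'.symm))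
  obtain ⟨H₁⟩ := nonempty_homotopy_zero_of_comp_τ H₀
  exact ⟨Homotopy.equivSubZero.symm H₁⟩

lemma IsInducedBy.comp {f : M ⟶ N} {g : N ⟶ L} {F : C.Q ⟶ D.Q} {F' : D.Q ⟶ B.Q}
    (hF : C.IsInducedBy D f F) (hF' : D.IsInducedBy B g F') :
    C.IsInducedBy B (f ≫ g) (F ≫ F') := by
  obtain ⟨φ, hφ, ⟨H⟩⟩ := hF
  obtain ⟨φ', hφ', ⟨H'⟩⟩ := hF'
  refine ⟨φ ≫ φ', ?_, ⟨?_⟩⟩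
  · unfold IsLift at *
    rw [Category.assoc, hφ', ← Category.assoc, hφ, Category.assoc, Functor.map_comp]
  · refine (Homotopy.ofEq (Category.assoc _ _ _)).trans ((H'.compLeft F).trans
      ((Homotopy.ofEq (Category.assoc _ _ _).symm).trans
        ((H.compRight (HomologicalComplex.extendMap φ' natToInt)).trans (Homotopy.ofEq ?_))))
    simp [viaLeft, HomologicalComplex.extendMap_comp]

variable (C) in
lemma isInducedBy_id : C.IsInducedBy C (𝟙 M) (𝟙 C.Q) :=
  ⟨𝟙 _, by simp [IsLift], ⟨Homotopy.ofEq (by simp [viaLeft, HomologicalComplex.extendMap_id])⟩⟩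

lemma exists_homotopyEquiv (C D : CompleteResolution M) :
    ∃ e : HomotopyEquiv C.Q D.Q,
      C.IsInducedBy D (𝟙 M) e.hom ∧ D.IsInducedBy C (𝟙 M) e.inv := by
  obtain ⟨F, hF⟩ := C.exists_isInducedBy D (𝟙 M)
  obtain ⟨F', hF'⟩ := D.exists_isInducedBy C (𝟙 M)
  obtain ⟨H⟩ := (by simpa using hF.comp hF' : C.IsInducedBy C (𝟙 M) (F ≫ F')).nonempty_homotopy
    C.isInducedBy_id
  obtain ⟨H'⟩ := (by simpa using hF'.comp hF : D.IsInducedBy D (𝟙 M) (F' ≫ F)).nonempty_homotopy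
    D.isInducedBy_id
  exact ⟨⟨F, F', H, H'⟩, hF, hF'⟩

end CompleteResolution

/-! ### Syzygies of short exact sequences -/

section Syzygies

variable {R : Type u} [Ring R]

/-- Horseshoe lemma with the cover `T` of the left-hand module prescribed: `P × E` covers the middle
term, and the kernels form `U`. Equalities of objects are recorded because `IsSyzygy` asks for them.
-/
lemma exists_shortExact_kernels {S : ShortComplex (ModuleCat.{u} R)} (hS : S.ShortExact)
    {T : ShortComplex (ModuleCat.{u} R)} (hT : T.ShortExact) (e : T.X₃ = S.X₁)
    [Projective T.X₂] :
    ∃ U V W : ShortComplex (ModuleCat.{u} R), U.ShortExact ∧ V.ShortExact ∧ W.ShortExact ∧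
      Projective V.X₂ ∧ Projective W.X₂ ∧ U.X₁ = T.X₁ ∧ V.X₁ = U.X₂ ∧ W.X₁ = U.X₃ ∧
      V.X₃ = S.X₂ ∧ W.X₃ = S.X₃ := by
  obtain @⟨A, B, D, f, g, w⟩ := S
  obtain @⟨K, P, A', k, q, w'⟩ := T
  dsimp only at *
  subst e
  have hf : Function.Injective f.hom := hS.moduleCat_injective_f
  have hg : Function.Surjective g.hom := hS.moduleCat_surjective_g
  have hfg : Function.Exact f.hom g.hom :=
    (ShortComplex.ShortExact.moduleCat_exact_iff_function_exact _).1 hS.exact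
  have hk : Function.Injective k.hom := hT.moduleCat_injective_f
  have hq : Function.Surjective q.hom := hT.moduleCat_surjective_g
  have hkq : Function.Exact k.hom q.hom :=
    (ShortComplex.ShortExact.moduleCat_exact_iff_function_exact _).1 hT.exact
  obtain ⟨E, r, hE, hr'⟩ : ∃ (E : ModuleCat.{u} R) (r : E ⟶ D), Projective E ∧ Epi r :=
    ⟨Projective.over D, Projective.π D, inferInstance, inferInstance⟩
  have hr : Function.Surjective r.hom := (ModuleCat.epi_iff_surjective _).1 inferInstance
  have : Epi g := hS.epi_g
  let l : E ⟶ B := Projective.factorThru r g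
  have hl : ∀ x, g.hom (l.hom x) = r.hom x := fun x =>
    congr($(Projective.factorThru_comp r g) x)
  let φ : P × E →ₗ[R] B := (f.hom ∘ₗ q.hom).coprod l.hom
  have hφ : ∀ x, φ x = f.hom (q.hom x.1) + l.hom x.2 := fun x => by simp [φ]
  have hgφ : ∀ x, g.hom (φ x) = r.hom x.2 := fun x => by
    rw [hφ, map_add, hl, hfg.apply_apply_eq_zero, zero_add]
  have hφs : Function.Surjective φ := by
    intro b
    obtain ⟨x, hx⟩ := hr (g.hom b)
    obtain ⟨a, ha⟩ := (hfg (b - l.hom x)).1 (by rw [map_sub, hl, hx, sub_self])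
    obtain ⟨p, rfl⟩ := hq a
    exact ⟨(p, x), by rw [hφ, ha]; simp⟩
  let i : K →ₗ[R] LinearMap.ker φ := (LinearMap.inl R P E ∘ₗ k.hom).codRestrict _
    fun x => by simp [φ, hkq.apply_apply_eq_zero]
  let j : LinearMap.ker φ →ₗ[R] LinearMap.ker r.hom :=
    ((LinearMap.snd R P E) ∘ₗ (LinearMap.ker φ).subtype).codRestrict _ fun x => by
      have := hgφ x
      rw [x.2, map_zero] at this
      exact this.symm
  have hij : Function.Exact i j := by
    rintro ⟨⟨p, x⟩, hx⟩
    constructor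
    · intro h
      obtain rfl : x = 0 := congr_arg Subtype.val h
      obtain ⟨y, rfl⟩ := (hkq p).1 (hf (by simpa [φ] using hx))
      exact ⟨y, rfl⟩
    · rintro ⟨y, hy⟩
      have := congr_arg (fun z => z.1.2) hy
      exact Subtype.ext this.symm
  have hi : Function.Injective i := fun x y h => hk (congr_arg (fun z => z.1.1) h)
  have hj : Function.Surjective j := by
    rintro ⟨x, hx⟩
    obtain ⟨a, ha⟩ := (hfg (l.hom x)).1 (by rw [hl]; exact hx)
    obtain ⟨p, rfl⟩ := hq a
    exact ⟨⟨(-p, x), by simp [φ, ha]⟩, rfl⟩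
  refine ⟨ShortComplex.mk (ModuleCat.ofHom i) (ModuleCat.ofHom j)
      (by ext1; exact LinearMap.ext hij.apply_apply_eq_zero),
    LinearMap.shortComplexKer φ, LinearMap.shortComplexKer r.hom,
    ModuleCat.shortComplex_shortExact _ hij hi hj, LinearMap.shortExact_shortComplexKer hφs,
    LinearMap.shortExact_shortComplexKer hr, ?_, ?_, rfl, rfl, rfl, rfl, rfl⟩
  · exact Projective.of_iso (ModuleCat.biprodIsoProd P E) inferInstance
  · exact hE

/-- `IsSyzygy n K M` says that `K` is an `n`-th syzygy of `M`. -/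
def IsSyzygy : ℕ → ModuleCat.{u} R → ModuleCat.{u} R → Prop
  | 0, K, M => Nonempty (K ≅ M)
  | n + 1, K, M => ∃ S : ShortComplex (ModuleCat.{u} R),
      S.ShortExact ∧ Projective S.X₂ ∧ S.X₁ = K ∧ IsSyzygy n S.X₃ M

lemma IsSyzygy.exists_shortExact {n : ℕ} {K : ModuleCat.{u} R}
    {S : ShortComplex (ModuleCat.{u} R)} (hS : S.ShortExact) (hK : IsSyzygy n K S.X₁) :
    ∃ T : ShortComplex (ModuleCat.{u} R), T.ShortExact ∧ T.X₁ = K ∧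
      IsSyzygy n T.X₂ S.X₂ ∧ IsSyzygy n T.X₃ S.X₃ := by
  induction n generalizing K with
  | zero =>
    obtain ⟨e⟩ := hK
    refine ⟨ShortComplex.mk (e.hom ≫ S.f) S.g (by simp), ?_, rfl, ⟨Iso.refl _⟩, ⟨Iso.refl _⟩⟩
    exact ShortComplex.shortExact_of_iso
      (ShortComplex.isoMk e.symm (Iso.refl _) (Iso.refl _) (by simp) (by simp)) hS
  | succ n ih =>
    obtain ⟨T, hT, hP, rfl, hT₃⟩ := hK
    obtain ⟨T', hT', h₁, h₂, h₃⟩ := ih hT₃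
    obtain ⟨U, V, W, hU, hV, hW, hVP, hWP, hUT, hVU, hWU, hVT, hWT⟩ :=
      exists_shortExact_kernels hT' hT h₁.symm
    exact ⟨U, hU, hUT, ⟨V, hV, hVP, hVU, hVT ▸ h₂⟩, ⟨W, hW, hWP, hWU, hWT ▸ h₃⟩⟩

lemma IsSyzygy.hasProjectiveDimensionLT {n m : ℕ} {K M : ModuleCat.{u} R} (h : IsSyzygy n K M)
    (hM : HasProjectiveDimensionLT M (n + m + 1)) : HasProjectiveDimensionLT K (m + 1) := by
  induction n generalizing K m with
  | zero =>
    obtain ⟨e⟩ := h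
    rw [zero_add] at hM
    exact hasProjectiveDimensionLT_of_iso e.symm _
  | succ n ih =>
    obtain ⟨S, hS, hP, rfl, h₃⟩ := h
    have : n + 1 + m + 1 = n + (m + 1) + 1 := by lia
    exact hS.hasProjectiveDimensionLT_X₁ (m + 1) inferInstance (ih h₃ (this ▸ hM))

end Syzygies

/-! ### Injective dimension via Ext, and exactness of composites -/

section Ext

variable {C : Type u} [Category.{v} C] [Abelian C]

-- It suffices to test Ext against the class `𝓕` itself. Dimension shifting along cosyzygies reduces
-- to `Ext¹`, where the class of the extension of the cosyzygy by `X` vanishes, so `X` is a summand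
-- of an injective.
open Abelian in
lemma hasInjectiveDimensionLT_of_cosyzygies [EnoughInjectives C] (𝓕 : C → Prop) (d : ℕ)
    (hdim : ∀ X, 𝓕 X → HasProjectiveDimensionLT X (d + 1))
    (hcok : ∀ S : ShortComplex C, S.ShortExact → Injective S.X₂ → 𝓕 S.X₁ → 𝓕 S.X₃)
    (X : C) (hX : 𝓕 X) : HasInjectiveDimensionLT X (d + 1) := by
  let := HasExt.standard C
  have key : ∀ (j : ℕ) (X : C), 𝓕 X → (∀ Y, 𝓕 Y → ∀ x : Ext Y X (j + 1), x = 0) →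
      HasInjectiveDimensionLT X (j + 1) := by
    intro j
    induction j with
    | zero =>
      intro X hX h
      have hS : (ShortComplex.mk (Injective.ι X) _ (cokernel.condition _)).ShortExact :=
        { exact := ShortComplex.exact_cokernel (Injective.ι X) }
      have hzero := h _ (hcok _ hS inferInstance hX) hS.extClass
      obtain ⟨x, hx⟩ := Ext.contravariant_sequence_exact₁ hS _ (Ext.mk₀ (𝟙 X)) (add_zero 1)
        (by rw [hzero, Ext.zero_comp])
      obtain ⟨r, rfl⟩ := Ext.homEquiv₀.symm.surjective x
      have hr : Injective.ι X ≫ r = 𝟙 X :=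
        Ext.homEquiv₀.symm.injective (by simpa using hx)
      have : Injective X := Retract.injective ⟨Injective.ι X, r, hr⟩
      infer_instance
    | succ j ih =>
      intro X hX h
      have hS : (ShortComplex.mk (Injective.ι X) _ (cokernel.condition _)).ShortExact :=
        { exact := ShortComplex.exact_cokernel (Injective.ι X) }
      have h₃ := ih _ (hcok _ hS inferInstance hX) (by
        intro Y hY x
        obtain ⟨y, rfl⟩ := Ext.covariant_sequence_exact₃ Y hS x rfl (h Y hY _)
        rw [y.eq_zero_of_injective, Ext.zero_comp])
      exact hS.hasInjectiveDimensionLT_X₁ (j + 1) h₃ inferInstance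
  exact key d X hX fun Y hY x =>
    have := hdim Y hY
    x.eq_zero_of_hasProjectiveDimensionLT (d + 1) le_rfl

lemma CategoryTheory.ShortComplex.Exact.epi_comp {S : ShortComplex C} (hS : S.Exact) {X : C}
    (p : X ⟶ S.X₁) [Epi p] : (ShortComplex.mk (p ≫ S.f) S.g (by simp)).Exact :=
  (ShortComplex.exact_iff_of_epi_of_isIso_of_mono
    (S₁ := ShortComplex.mk (p ≫ S.f) S.g (by simp)) (S₂ := S)
    { τ₁ := p, τ₂ := 𝟙 _, τ₃ := 𝟙 _ }).2 hS

lemma CategoryTheory.ShortComplex.Exact.comp_mono {S : ShortComplex C} (hS : S.Exact) {Y : C}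
    (i : S.X₃ ⟶ Y) [Mono i] : (ShortComplex.mk S.f (S.g ≫ i) (by simp)).Exact :=
  (ShortComplex.exact_iff_of_epi_of_isIso_of_mono
    (S₁ := S) (S₂ := ShortComplex.mk S.f (S.g ≫ i) (by simp))
    { τ₁ := 𝟙 _, τ₂ := 𝟙 _, τ₃ := i }).1 hS

end Ext

/-! ### Hom-exactness from finite injective dimension -/

section HomExact

variable {R : Type u} [Ring R] {Q : ChainComplex (ModuleCat.{u} R) ℤ}

lemma homExact_of_injective (hQ : Q.Acyclic) (X : ModuleCat.{u} R) [Injective X] :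
    HomExact Q X := by
  intro i f hf
  have h := (Q.exactAt_iff' (i + 1) i (i - 1) (by simp) (by simp)).1 (hQ i)
  exact ⟨h.descToInjective f hf, h.comp_descToInjective f hf⟩

/-- As the terms of `Q` are projective, `Hom(Q, -)` turns `S` into a short exact sequence of
complexes; two are exact, so the third is. The proof is the corresponding chase. -/
lemma HomExact.of_shortExact {S : ShortComplex (ModuleCat.{u} R)} (hS : S.ShortExact)
    (hQ : ∀ i, Projective (Q.X i)) (h₂ : HomExact Q S.X₂) (h₃ : HomExact Q S.X₃) :
    HomExact Q S.X₁ := by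
  intro i f hf
  have := hS.mono_f
  have := hS.epi_g
  obtain ⟨g, hg⟩ := h₂ i (f ≫ S.f) (by rw [← Category.assoc, hf, zero_comp])
  obtain ⟨h, hh⟩ := h₃.exists_desc (k := i) (i := i - 1) (j := i - 1 - 1) (by lia) (by lia)
    (g ≫ S.g) (by rw [← Category.assoc, hg, Category.assoc, S.zero, comp_zero])
  have hlift : Q.d (i - 1) (i - 1 - 1) ≫ Projective.factorThru h S.g ≫ S.g = g ≫ S.g := by
    rw [Projective.factorThru_comp, hh]
  refine ⟨hS.exact.lift (g - Q.d (i - 1) (i - 1 - 1) ≫ Projective.factorThru h S.g)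
    (by simp [Preadditive.sub_comp, hh]), ?_⟩
  rw [← cancel_mono S.f, Category.assoc, hS.exact.lift_f, Preadditive.comp_sub, hg]
  simp

lemma homExact_of_hasInjectiveDimensionLT (hQ : Q.Acyclic) (hQ' : ∀ i, Projective (Q.X i))
    (n : ℕ) (X : ModuleCat.{u} R) (hX : HasInjectiveDimensionLT X (n + 1)) : HomExact Q X := by
  induction n generalizing X with
  | zero =>
    have : Injective X := injective_iff_hasInjectiveDimensionLT_one.2 hX
    exact homExact_of_injective hQ X
  | succ n ih =>
    have hS : (ShortComplex.mk (Injective.ι X) _ (cokernel.condition _)).ShortExact :=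
      { exact := ShortComplex.exact_cokernel (Injective.ι X) }
    exact HomExact.of_shortExact hS hQ' (homExact_of_injective hQ _)
      (ih _ ((hS.hasInjectiveDimensionLT_X₃_iff n inferInstance).2 hX))

end HomExact

/-! ### Splicing a resolution with a coresolution -/

section Splice

variable {R : Type u} [Ring R]

lemma CategoryTheory.ProjectiveResolution.isSyzygy_cokernel {M : ModuleCat.{u} R}
    (P : ProjectiveResolution M) (n : ℕ) : IsSyzygy n (cokernel (P.complex.d (n + 1) n)) M := by
  induction n with
  | zero =>
    exact ⟨IsColimit.coconePointUniqueUpToIso (colimit.isColimit _) P.isColimitCokernelCofork⟩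
  | succ n ih =>
    have hmono : Mono (cokernel.desc (P.complex.d (n + 2) (n + 1)) (P.complex.d (n + 1) n)
        (by simp)) := (P.exact_succ n).mono_cokernelDesc
    refine ⟨ShortComplex.mk (cokernel.desc (P.complex.d (n + 2) (n + 1)) (P.complex.d (n + 1) n)
        (by simp)) (cokernel.π (P.complex.d (n + 1) n))
        (by rw [← cancel_epi (cokernel.π _)]; simp), ?_, P.projective n, rfl, ih⟩
    exact
      { exact := (ShortComplex.exact_iff_of_epi_of_isIso_of_mono
          (S₁ := ShortComplex.mk (P.complex.d (n + 1) n) (cokernel.π _) (cokernel.condition _))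
          (S₂ := ShortComplex.mk (cokernel.desc (P.complex.d (n + 2) (n + 1))
            (P.complex.d (n + 1) n) (by simp)) (cokernel.π (P.complex.d (n + 1) n))
            (by rw [← cancel_epi (cokernel.π _)]; simp))
          { τ₁ := cokernel.π _, τ₂ := 𝟙 _, τ₃ := 𝟙 _ }).1 (ShortComplex.exact_cokernel _) }

/-- A module `K` in a class of modules each of which embeds in a projective module with cokernel
in the class has a coresolution by projective modules. -/
lemma exists_projective_coresolution (𝓢 : ModuleCat.{u} R → Prop)
    (h𝓢 : ∀ K, 𝓢 K → ∃ S : ShortComplex (ModuleCat.{u} R), S.ShortExact ∧ S.X₁ = K ∧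
      Projective S.X₂ ∧ 𝓢 S.X₃) (K : ModuleCat.{u} R) (hK : 𝓢 K) :
    ∃ (L : CochainComplex (ModuleCat.{u} R) ℕ) (ι : K ⟶ L.X 0) (w : ι ≫ L.d 0 1 = 0),
      Mono ι ∧ (∀ n, Projective (L.X n)) ∧ (ShortComplex.mk ι (L.d 0 1) w).Exact ∧
      ∀ n, (L.sc' n (n + 1) (n + 2)).Exact := by
  have step : ∀ A : {A // 𝓢 A}, ∃ (P : ModuleCat.{u} R) (B : {B // 𝓢 B}) (f : A.1 ⟶ P)
      (g : P ⟶ B.1) (w : f ≫ g = 0), (ShortComplex.mk f g w).ShortExact ∧ Projective P := by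
    rintro ⟨A, hA⟩
    obtain ⟨S, hS, rfl, hP, h₃⟩ := h𝓢 A hA
    exact ⟨S.X₂, ⟨S.X₃, h₃⟩, S.f, S.g, S.zero, hS, hP⟩
  choose P B f g w hS hP using step
  let A : ℕ → {A // 𝓢 A} := fun n => Nat.rec ⟨K, hK⟩ (fun _ A => B A) n
  have (a : _) : Mono (f a) := (hS a).mono_f
  have (a : _) : Epi (g a) := (hS a).epi_g
  let δ : ∀ n, P (A n) ⟶ P (A (n + 1)) := fun n => g (A n) ≫ f (B (A n))
  let L := CochainComplex.of (fun n => P (A n)) δ (fun n => by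
    have : f (B (A n)) ≫ g (B (A n)) = 0 := w _
    change (g (A n) ≫ f (B (A n))) ≫ g (B (A n)) ≫ f (B (B (A n))) = 0
    rw [Category.assoc, reassoc_of% this, zero_comp, comp_zero])
  have hd : ∀ n, L.d n (n + 1) = g (A n) ≫ f (B (A n)) :=
    fun n => CochainComplex.of_d (fun n => P (A n)) δ n
  have hex := (hS (A 0)).exact.comp_mono (f (B (A 0)))
  refine ⟨L, f (A 0), ?_, inferInstance, fun n => hP _, ?_, fun n => ?_⟩
  · rw [hd, ← Category.assoc, w, zero_comp]
  · convert! hex using 2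
  · convert! ((hS (A (n + 1))).exact.epi_comp (g (A n))).comp_mono
      (f (B (A (n + 1)))) using 2
    · exact hd n
    · exact hd (n + 1)

end Splice

section Splice

variable {R : Type u} [Ring R]

/-- The part of a chain complex in degrees `≥ d`, moved to degree `0`. -/
def ChainComplex.tail {C : Type u} [Category.{v} C] [HasZeroMorphisms C] (K : ChainComplex C ℕ)
    (d : ℕ) : ChainComplex C ℕ where
  X n := K.X (d + n)
  d i j := K.d (d + i) (d + j)
  shape i j h := K.shape _ _ (fun h' => h (by
    have : d + j + 1 = d + i := h'
    exact (by lia : j + 1 = i)))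

/-- A cochain complex indexed by `ℤ`, turned into a chain complex by `i ↦ d - 1 - i`. -/
def CochainComplex.reflect {C : Type u} [Category.{v} C] [HasZeroMorphisms C]
    (K : CochainComplex C ℤ) (d : ℤ) : ChainComplex C ℤ where
  X i := K.X (d - 1 - i)
  d i j := K.d (d - 1 - i) (d - 1 - j)
  shape i j h := K.shape _ _ (fun h' => h (by
    have : d - 1 - i + 1 = d - 1 - j := h'
    exact (by lia : j + 1 = i)))

lemma CochainComplex.reflect_acyclic {C : Type u} [Category.{v} C] [Abelian C]
    (K : CochainComplex C ℤ) (d : ℤ)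
    (hK : ∀ a b c : ℤ, a + 1 = b → b + 1 = c → (K.sc' a b c).Exact) : (K.reflect d).Acyclic := by
  intro i
  rw [(K.reflect d).exactAt_iff' (i + 1) i (i - 1) (by simp) (by simp)]
  exact hK (d - 1 - (i + 1)) (d - 1 - i) (d - 1 - (i - 1)) (by lia) (by lia)

lemma CochainComplex.ConnectData.sc'_exact {C : Type u} [Category.{v} C] [Abelian C]
    {K : ChainComplex C ℕ} {L : CochainComplex C ℕ} (h : CochainComplex.ConnectData K L)
    (hK : ∀ n, (K.sc' (n + 2) (n + 1) n).Exact) (hL : ∀ n, (L.sc' n (n + 1) (n + 2)).Exact)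
    (h₁ : (ShortComplex.mk _ _ h.comp_d₀).Exact) (h₂ : (ShortComplex.mk _ _ h.d₀_comp).Exact)
    (a b c : ℤ) (hab : a + 1 = b) (hbc : b + 1 = c) : (h.cochainComplex.sc' a b c).Exact := by
  obtain (_ | n) | (_ | n) := b
  · obtain rfl : a = .negSucc 0 := by lia
    obtain rfl : c = .ofNat 1 := by lia
    exact h₂
  · obtain rfl : a = .ofNat n := by lia
    obtain rfl : c = .ofNat (n + 2) := by lia
    exact hL n
  · obtain rfl : a = .negSucc 1 := by lia
    obtain rfl : c = .ofNat 0 := by lia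
    exact h₁
  · obtain rfl : a = .negSucc (n + 2) := by lia
    obtain rfl : c = .negSucc n := by lia
    refine (ShortComplex.exact_iff_of_iso (ShortComplex.isoMk (Iso.refl _) (Iso.refl _)
      (Iso.refl _) ?_ ?_)).1 (hK n)
    · exact (Category.id_comp _).trans ((h.d_negSucc _ _).trans (Category.comp_id _).symm)
    · exact (Category.id_comp _).trans ((h.d_negSucc _ _).trans (Category.comp_id _).symm)

lemma CategoryTheory.Iso.trans_symm_hom_comp {C : Type u} [Category.{v} C] {A A' B B' E E' : C}
    {x : A ≅ B} {x' : A' ≅ B'} {y : E ≅ B} {y' : E' ≅ B'} {dA : A' ⟶ A} {dB : B' ⟶ B}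
    {dE : E' ⟶ E} (hA : dA ≫ x.hom = x'.hom ≫ dB) (hE : dE = y'.hom ≫ dB ≫ y.inv) :
    (x' ≪≫ y'.symm).hom ≫ dE = dA ≫ (x ≪≫ y.symm).hom := by
  simp [hE, reassoc_of% hA]

lemma exists_hom_reflect_extend {K : ChainComplex (ModuleCat.{u} R) ℕ}
    {L : CochainComplex (ModuleCat.{u} R) ℕ} {d : ℕ}
    (h : CochainComplex.ConnectData (K.tail d) L)
    (hQ : ∀ i, HomExact (h.cochainComplex.reflect d) ((K.extend natToInt).X i)) :
    ∃ τ : h.cochainComplex.reflect d ⟶ K.extend natToInt, ∀ i : ℤ, (d : ℤ) ≤ i → IsIso (τ.f i) := by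
  classical
  -- `ConnectData` puts the `n`-th term of the tail in cohomological degree `-(n + 1)`, so
  -- reflection by `d - 1 - i` returns it to its original degree `d + n`.
  have h₁ : ∀ i : ℤ, (d : ℤ) ≤ i → (d : ℤ) - 1 - i = .negSucc (i - d).toNat := by lia
  have h₂ : ∀ i : ℤ, (d : ℤ) ≤ i → natToInt.f (d + (i - d).toNat) = i := by
    intro i hi
    change ((d + (i - d).toNat : ℕ) : ℤ) = i
    lia
  let t : ∀ (n : ℕ) (i : ℤ) (_ : (d : ℤ) - 1 - i = .negSucc n) (_ : natToInt.f (d + n) = i),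
      (h.cochainComplex.reflect d).X i ≅ (K.extend natToInt).X i := fun n i h₁ h₂ =>
    (h.cochainComplex.XIsoOfEq h₁).trans (K.extendXIso natToInt h₂).symm
  have ht : ∀ (n n' : ℕ) (i i' : ℤ) (h₁ : (d : ℤ) - 1 - i = .negSucc n)
      (h₂ : natToInt.f (d + n) = i) (h₁' : (d : ℤ) - 1 - i' = .negSucc n')
      (h₂' : natToInt.f (d + n') = i'),
      (t n' i' h₁' h₂').hom ≫ (K.extend natToInt).d i' i =
        (h.cochainComplex.reflect d).d i' i ≫ (t n i h₁ h₂).hom := by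
    intro n n' i i' h₁ h₂ h₁' h₂'
    refine CategoryTheory.Iso.trans_symm_hom_comp (B := K.X (d + n)) (B' := K.X (d + n'))
      (dB := K.d (d + n') (d + n)) ?_ (K.extend_d_eq natToInt h₂' h₂)
    have hd : h.cochainComplex.d (.negSucc n') (.negSucc n) = K.d (d + n') (d + n) :=
      h.d_negSucc n' n
    exact (HomologicalComplex.d_comp_XIsoOfEq_hom _ h₁ _).trans
      ((HomologicalComplex.XIsoOfEq_hom_comp_d _ h₁' _).symm.trans
        (congrArg (fun z => (h.cochainComplex.XIsoOfEq h₁').hom ≫ z) hd))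
  obtain ⟨τ, hτ⟩ := exists_hom_extending hQ d
    (fun i => if hi : (d : ℤ) ≤ i then (t _ i (h₁ i hi) (h₂ i hi)).hom else 0) (by
      intro i hi
      have hi' : (d : ℤ) ≤ i + 1 := hi.trans (by simp)
      rw [dif_pos hi, dif_pos hi']
      exact ht _ _ _ _ _ _ _ _)
  refine ⟨τ, fun i hi => ?_⟩
  rw [hτ i hi, dif_pos hi]
  infer_instance

/-- A module has a complete resolution with coincidence index `d` if injective modules have
projective dimension at most `d` and projective modules have finite injective dimension. -/
lemma exists_completeResolution (d m : ℕ)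
    (hI : ∀ I : ModuleCat.{u} R, Injective I → HasProjectiveDimensionLT I (d + 1))
    (hP : ∀ X : ModuleCat.{u} R, Projective X → HasInjectiveDimensionLT X (m + 1))
    (M : ModuleCat.{u} R) : ∃ C : CompleteResolution M, C.n = d := by
  let P := projectiveResolution M
  let K := cokernel (P.complex.d (d + 1) d)
  obtain ⟨L, ι, w, hι, hL, hw, hex⟩ := exists_projective_coresolution
    (fun K => ∃ N, IsSyzygy d K N) (by
      rintro K ⟨N, hN⟩
      have hS : (ShortComplex.mk (Injective.ι N) _ (cokernel.condition _)).ShortExact :=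
        { exact := ShortComplex.exact_cokernel (Injective.ι N) }
      obtain ⟨T, hT, h₁, h₂, h₃⟩ := IsSyzygy.exists_shortExact hS hN
      -- The injective hull term has projective dimension at most `d`, so its `d`-th syzygy is
      -- projective.
      have := h₂.hasProjectiveDimensionLT (m := 0) (hI _ inferInstance)
      exact ⟨T, hT, h₁, inferInstance, _, h₃⟩) K ⟨M, P.isSyzygy_cokernel d⟩
  have hdι := (ShortComplex.exact_cokernel (P.complex.d (d + 1) d)).comp_mono ι
  have hπι := hw.epi_comp (cokernel.π (P.complex.d (d + 1) d))
  have hdι' : P.complex.d (d + 1) d ≫ cokernel.π (P.complex.d (d + 1) d) ≫ ι = 0 :=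
    cokernel.condition_assoc _ _ |>.trans zero_comp
  have hπι' : (cokernel.π (P.complex.d (d + 1) d) ≫ ι) ≫ L.d 0 1 = 0 := by
    rw [Category.assoc, w, comp_zero]
  let h : CochainComplex.ConnectData (P.complex.tail d) L :=
    { d₀ := cokernel.π (P.complex.d (d + 1) d) ≫ ι
      comp_d₀ := hdι'
      d₀_comp := hπι' }
  let A := h.cochainComplex
  let Q : ChainComplex (ModuleCat.{u} R) ℤ := A.reflect d
  have hQ : Q.Acyclic := A.reflect_acyclic d
    (h.sc'_exact (fun n => P.exact_succ (d + n)) hex hdι hπι)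
  have hA : ∀ i, Projective (A.X i) := by
    rintro (n | n)
    · exact hL n
    · exact P.projective (d + n)
  have hQ' : ∀ i, Projective (Q.X i) := fun i => hA _
  have hQP : ∀ X, Projective X → HomExact Q X := fun X hX =>
    homExact_of_hasInjectiveDimensionLT hQ hQ' m X (hP X hX)
  obtain ⟨τ, hτ⟩ := exists_hom_reflect_extend h fun i => hQP _ (P.projective_extend_X i)
  exact ⟨⟨P, Q, τ, d, hQ', hQ, hQP, hτ⟩, rfl⟩

end Splice

/-! ### Higman's trace criterion -/

section TraceOne

open MonoidAlgebra

variable {k : Type*} [Field k] {G H : Type*} [Group G] [Group H] [Fintype H] (ι : H →* G)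

/-- Higman's condition on a `kG`-module, with respect to a homomorphism `ι` from a finite group:
the identity is the trace of a `k`-linear endomorphism. -/
def HasTraceOne (M : Type*) [AddCommGroup M] [Module (MonoidAlgebra k G) M] : Prop :=
  ∃ θ : M →+ M, (∀ (c : k) (m : M), θ ((single 1 c : MonoidAlgebra k G) • m) =
      (single 1 c : MonoidAlgebra k G) • θ m) ∧
    ∀ m : M, ∑ h : H, (single (ι h⁻¹) 1 : MonoidAlgebra k G) •
      θ ((single (ι h) 1 : MonoidAlgebra k G) • m) = m

variable {M : Type*} [AddCommGroup M] [Module (MonoidAlgebra k G) M]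

lemma isScalarTower_compHom_algebraMap (k : Type*) [Field k] (G : Type*) [Group G] (M : Type*)
    [AddCommGroup M] [Module (MonoidAlgebra k G) M] :
    letI := Module.compHom M (algebraMap k (MonoidAlgebra k G))
    IsScalarTower k (MonoidAlgebra k G) M :=
  let := Module.compHom M (algebraMap k (MonoidAlgebra k G))
  ⟨fun c r m => by
    rw [Algebra.smul_def, mul_smul]
    rfl⟩

lemma HasTraceOne.pi {α : Type*} {M : α → Type*} [∀ a, AddCommGroup (M a)]
    [∀ a, Module (MonoidAlgebra k G) (M a)] (hM : ∀ a, HasTraceOne (k := k) ι (M a)) :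
    HasTraceOne (k := k) ι (∀ a, M a) := by
  choose θ hθ hsum using hM
  refine ⟨AddMonoidHom.mk' (fun m a => θ a (m a)) fun m m' => by ext; simp, fun c m => ?_,
    fun m => ?_⟩
  · ext a
    exact hθ a c (m a)
  · ext a
    rw [Finset.sum_apply]
    exact hsum a (m a)

/-- As in Maschke's theorem, with `θ` replacing division by the group order: for a `k`-linear
section `s` of `f`, the sum of the conjugates of `s ∘ θ` is an equivariant section. -/
lemma HasTraceOne.module_projective {M : Type*} [AddCommGroup M] [Module (MonoidAlgebra k H) M]
    (hM : HasTraceOne (k := k) (MonoidHom.id H) M) : Module.Projective (MonoidAlgebra k H) M := by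
  let := Module.compHom M (algebraMap k (MonoidAlgebra k H))
  have := isScalarTower_compHom_algebraMap k H M
  obtain ⟨θ, hθ, hsum⟩ := hM
  let θ' : M →ₗ[k] M := { θ with map_smul' := hθ }
  refine Module.Projective.of_lifting_property'' fun f hf => ?_
  obtain ⟨s, hs⟩ := (f.restrictScalars k).exists_rightInverse_of_surjective
    (LinearMap.range_eq_top.2 hf)
  refine ⟨(s ∘ₗ θ').sumOfConjugatesEquivariant H, ?_⟩
  ext m
  have hs' : ∀ x, f (s x) = x := fun x => congr($hs x)
  rw [LinearMap.comp_apply, LinearMap.sumOfConjugatesEquivariant_apply, map_sum]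
  simp only [LinearMap.conjugate_apply, map_smul, LinearMap.comp_apply, hs']
  exact hsum m

/-- Dually, sum the conjugates of `θ ∘ f ∘ r`, where `r` is a `k`-linear retraction onto the ideal
in Baer's criterion. -/
lemma HasTraceOne.module_injective {k : Type u} [Field k] {H : Type v} [Group H] [Fintype H]
    {M : Type (max u v)} [AddCommGroup M] [Module (MonoidAlgebra k H) M]
    (hM : HasTraceOne (k := k) (MonoidHom.id H) M) : Module.Injective (MonoidAlgebra k H) M := by
  let := Module.compHom M (algebraMap k (MonoidAlgebra k H))
  have := isScalarTower_compHom_algebraMap k H M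
  obtain ⟨θ, hθ, hsum⟩ := hM
  let θ' : M →ₗ[k] M := { θ with map_smul' := hθ }
  refine Module.Baer.injective fun I f => ?_
  obtain ⟨r, hr⟩ := (I.subtype.restrictScalars k).exists_leftInverse_of_injective
    (LinearMap.ker_eq_bot.2 I.injective_subtype)
  refine ⟨(θ' ∘ₗ f.restrictScalars k ∘ₗ r).sumOfConjugatesEquivariant H, fun x hx => ?_⟩
  have hr' : ∀ y : I, r (y : MonoidAlgebra k H) = y := fun y => congr($hr y)
  rw [LinearMap.sumOfConjugatesEquivariant_apply]
  have hx' : ∀ h : H, (single h 1 : MonoidAlgebra k H) • x =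
      (((single h 1 : MonoidAlgebra k H) • (⟨x, hx⟩ : I) : I) : MonoidAlgebra k H) := fun h => rfl
  simp only [LinearMap.conjugate_apply, LinearMap.comp_apply, hx', hr',
    LinearMap.coe_restrictScalars, map_smul]
  exact hsum _

lemma exists_transversal {G H : Type*} [Group G] [Group H] (ι : H →* G)
    (hι : Function.Injective ι) :
    ∃ T : Set G, ∀ g : G, ∃! h : H, ι h * g ∈ T := by
  obtain ⟨T, hT, -⟩ := ι.range.exists_isComplement_right 1
  refine ⟨T, fun g => ?_⟩
  obtain ⟨⟨_, ⟨h, rfl⟩⟩, hs, huniq⟩ := Subgroup.isComplement_iff_existsUnique_inv_mul_mem.1 hT g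
  refine ⟨h⁻¹, by simpa using hs, fun h' hh' => ?_⟩
  have := congr_arg Subtype.val (huniq ⟨ι h'⁻¹, h'⁻¹, rfl⟩ (by simpa using hh'))
  rw [← hι this, inv_inv]

lemma sum_ite_transversal {A : Type*} [AddCommMonoid A] {T : Set G} [DecidablePred (· ∈ T)]
    (hT : ∀ g : G, ∃! h : H, ι h * g ∈ T) (g : G) (a : A) :
    ∑ h : H, (if ι h * g ∈ T then a else 0) = a := by
  obtain ⟨h₀, h₁, h₂⟩ := hT g
  rw [Finset.sum_eq_single h₀ (fun h _ hh => if_neg fun h' => hh (h₂ h h')) (by simp), if_pos h₁]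

/-- `θ` projects onto the span of a transversal `T`; for each `g` exactly one translate `ι h * g`
survives, and `ι h⁻¹` moves it back. -/
lemma hasTraceOne_monoidAlgebra (hι : Function.Injective ι) :
    HasTraceOne (k := k) ι (MonoidAlgebra k G) := by
  classical
  obtain ⟨T, hT⟩ := exists_transversal ι hι
  let θ : MonoidAlgebra k G →+ MonoidAlgebra k G :=
    (coeffAddEquiv.symm.toAddMonoidHom.comp (Finsupp.filterAddHom (· ∈ T))).comp
      coeffAddEquiv.toAddMonoidHom
  have hθ : ∀ (g : G) (a : k), θ (single g a) = if g ∈ T then single g a else 0 := by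
    intro g a
    apply coeff_injective
    split_ifs with hg
    · exact Finsupp.filter_single_of_pos _ hg
    · exact Finsupp.filter_single_of_neg _ hg
  refine ⟨θ, fun c m => ?_, fun m => ?_⟩
  · induction m using MonoidAlgebra.induction_linear with
    | zero => simp
    | add x y hx hy => rw [smul_add, map_add, map_add, smul_add, hx, hy]
    | single g a =>
      rw [smul_eq_mul, smul_eq_mul, single_mul_single, one_mul, hθ, hθ]
      split_ifs
      · rw [single_mul_single, one_mul]
      · rw [mul_zero]
  · induction m using MonoidAlgebra.induction_linear with
    | zero => simp
    | add x y hx hy =>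
      simp only [smul_add, map_add, Finset.sum_add_distrib]
      rw [hx, hy]
    | single g a =>
      refine Eq.trans (Finset.sum_congr rfl fun h _ => ?_)
        (sum_ite_transversal ι hT g (single g a : MonoidAlgebra k G))
      rw [smul_eq_mul, smul_eq_mul, single_mul_single, one_mul, hθ]
      split_ifs
      · rw [single_mul_single, one_mul, map_inv, inv_mul_cancel_left]
      · rw [mul_zero]

lemma HasTraceOne.finsupp (hM : HasTraceOne (k := k) ι M) (α : Type*) :
    HasTraceOne (k := k) ι (α →₀ M) := by
  obtain ⟨θ, hθ, hsum⟩ := hM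
  refine ⟨Finsupp.mapRange.addMonoidHom θ, fun c m => ?_, fun m => ?_⟩
  · ext a
    simp [hθ]
  · ext a
    rw [Finsupp.finsetSum_apply]
    exact hsum (m a)

lemma HasTraceOne.of_retract {N : Type*} [AddCommGroup N] [Module (MonoidAlgebra k G) N]
    (hN : HasTraceOne (k := k) ι N) (i : M →ₗ[MonoidAlgebra k G] N)
    (r : N →ₗ[MonoidAlgebra k G] M) (h : ∀ m, r (i m) = m) : HasTraceOne (k := k) ι M := by
  obtain ⟨θ, hθ, hsum⟩ := hN
  refine ⟨(r.toAddMonoidHom.comp θ).comp i.toAddMonoidHom, fun c m => ?_, fun m => ?_⟩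
  · simp [hθ]
  · have := congr_arg r (hsum (i m))
    simpa [h] using this

lemma HasTraceOne.of_module_projective (hι : Function.Injective ι)
    [hM : Module.Projective (MonoidAlgebra k G) M] : HasTraceOne (k := k) ι M := by
  obtain ⟨s, hs⟩ := Module.projective_def'.1 hM
  exact ((hasTraceOne_monoidAlgebra ι hι).finsupp ι M).of_retract ι s
    (Finsupp.linearCombination _ id) fun m => congr($hs m)

/-- The coinduced representation on the functions `G → M`. -/
def coindFun (k : Type*) [Field k] (G : Type*) [Group G] (M : Type*) [AddCommGroup M]
    [Module k M] : Representation k G (G → M) where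
  toFun g := LinearMap.funLeft k M (fun x => g⁻¹ * x)
  map_one' := by ext; simp [LinearMap.funLeft]
  map_mul' g g' := by ext; simp [LinearMap.funLeft, mul_assoc]

/-- The function underlying an element of the coinduced module. -/
def coindFunEval {M : Type*} [AddCommGroup M] [Module k M] :
    (coindFun k G M).asModule ≃+ (G → M) := AddEquiv.refl _

lemma coindFunEval_smul {M : Type*} [AddCommGroup M] [Module k M] (g : G) (c : k)
    (φ : (coindFun k G M).asModule) (x : G) :
    coindFunEval ((single g c : MonoidAlgebra k G) • φ) x = c • coindFunEval φ (g⁻¹ * x) :=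
  congr_fun (Representation.single_smul _ c g φ : _ = (_ : G → M)) x

lemma hasTraceOne_coindFun (hι : Function.Injective ι) (M : Type*) [AddCommGroup M] [Module k M] :
    HasTraceOne (k := k) ι (coindFun k G M).asModule := by
  classical
  obtain ⟨T, hT⟩ := exists_transversal ι hι
  let cut : (G → M) →+ (G → M) :=
    AddMonoidHom.mk' (fun φ x => if x ∈ T then φ x else 0) fun φ ψ => by
      ext x
      by_cases hx : x ∈ T <;> simp [hx]
  let θ : (coindFun k G M).asModule →+ (coindFun k G M).asModule :=
    (coindFunEval.symm.toAddMonoidHom.comp cut).comp coindFunEval.toAddMonoidHom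
  have hθ : ∀ (φ : (coindFun k G M).asModule) x,
      coindFunEval (θ φ) x = if x ∈ T then coindFunEval φ x else 0 := fun _ _ => rfl
  refine ⟨θ, fun c φ => coindFunEval.injective ?_, fun φ => coindFunEval.injective ?_⟩
  · ext x
    rw [hθ, coindFunEval_smul, coindFunEval_smul, hθ, inv_one, one_mul, smul_ite, smul_zero]
  · ext x
    rw [map_sum, Finset.sum_apply]
    refine Eq.trans ?_ (sum_ite_transversal ι hT x (coindFunEval φ x))
    simp only [hθ, coindFunEval_smul, map_inv, inv_inv, one_smul, inv_mul_cancel_left]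

/-- The embedding of a module into the coinduced module. -/
def toCoindFun [Module k M] [IsScalarTower k (MonoidAlgebra k G) M] :
    M →ₗ[MonoidAlgebra k G] (coindFun k G M).asModule where
  toFun m := coindFunEval.symm fun x => (single x⁻¹ 1 : MonoidAlgebra k G) • m
  map_add' m m' := coindFunEval.injective (by ext x; simp)
  map_smul' r m := coindFunEval.injective (by
    induction r using MonoidAlgebra.induction_linear with
    | zero => ext x; simp
    | add r r' hr hr' =>
      rw [RingHom.id_apply] at hr hr' ⊢
      rw [add_smul, add_smul, map_add, ← hr, ← hr']
      ext x
      simp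
    | single g c =>
      ext x
      rw [RingHom.id_apply, coindFunEval_smul, AddEquiv.apply_symm_apply, AddEquiv.apply_symm_apply,
        smul_smul, ← smul_assoc, single_mul_single, one_mul, smul_single, smul_eq_mul, mul_one,
        mul_inv_rev, inv_inv])

lemma toCoindFun_injective [Module k M] [IsScalarTower k (MonoidAlgebra k G) M] :
    Function.Injective (toCoindFun : M →ₗ[MonoidAlgebra k G] (coindFun k G M).asModule) := by
  intro m m' h
  have : (single (1 : G)⁻¹ 1 : MonoidAlgebra k G) • m =
      (single (1 : G)⁻¹ 1 : MonoidAlgebra k G) • m' := congr_fun (congr_arg coindFunEval h) (1 : G)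
  simpa [← MonoidAlgebra.one_def] using this

/-- An injective module is a retract of the coinduced module in which it embeds, and there cutting
functions off outside a transversal gives trace one. -/
lemma HasTraceOne.of_injective {k : Type u} [Field k] {G : Type v} [Group G]
    {H : Type v} [Group H] [Fintype H] (ι : H →* G) (hι : Function.Injective ι)
    (M : ModuleCat.{max u v} (MonoidAlgebra k G)) [Injective M] : HasTraceOne (k := k) ι M := by
  let := Module.compHom M (algebraMap k (MonoidAlgebra k G))
  have := isScalarTower_compHom_algebraMap k G M
  let i : M ⟶ ModuleCat.of _ (coindFun k G M).asModule := ModuleCat.ofHom toCoindFun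
  have : Mono i := (ModuleCat.mono_iff_injective _).2 toCoindFun_injective
  exact (hasTraceOne_coindFun ι hι M).of_retract ι i.hom (Injective.factorThru (𝟙 M) i).hom
    fun m => congr($(Injective.comp_factorThru (𝟙 M) i) m)

end TraceOne

/-! ### Modules over finite groups -/

section FiniteGroup

variable {k : Type u} {H : Type v} [Field k] [Group H] [Finite H]

lemma injective_of_projective_of_finite (N : ModuleCat.{max u v} (MonoidAlgebra k H))
    [Projective N] : Injective N := by
  have := Fintype.ofFinite H
  have : Module.Projective (MonoidAlgebra k H) N := (IsProjective.iff_projective N).2 ‹_›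
  have := (HasTraceOne.of_module_projective (k := k) (M := N) (MonoidHom.id H)
    Function.injective_id).module_injective
  exact Module.injective_object_of_injective_module (MonoidAlgebra k H) N

lemma projective_X₃_of_finite {S : ShortComplex (ModuleCat.{max u v} (MonoidAlgebra k H))}
    (hS : S.ShortExact) (h₁ : Projective S.X₁) (h₂ : Projective S.X₂) : Projective S.X₃ := by
  have := injective_of_projective_of_finite S.X₁
  let σ := hS.splittingOfInjective
  exact Retract.projective ⟨σ.s, S.g, σ.s_g⟩

/-- Projectives are injective here, so a projective resolution of finite length splits from its left
end. -/
lemma projective_of_hasProjectiveDimensionLT_of_finite (n : ℕ)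
    (N : ModuleCat.{max u v} (MonoidAlgebra k H)) (hN : HasProjectiveDimensionLT N (n + 1)) :
    Projective N := by
  induction n generalizing N with
  | zero => exact projective_iff_hasProjectiveDimensionLT_one.2 hN
  | succ n ih =>
    have hS : (ShortComplex.mk _ (Projective.π N) (kernel.condition _)).ShortExact :=
      { exact := ShortComplex.exact_kernel (Projective.π N) }
    exact projective_X₃_of_finite hS
      (ih _ ((hS.hasProjectiveDimensionLT_X₃_iff n inferInstance).1 hN)) inferInstance

end FiniteGroup

/-! ### Groups of type `Φ` -/

section TypePhi

variable {k : Type u} {G : Type v} [Field k] [Group G]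

/-- Modules whose restrictions to all finite subgroups are projective. -/
def IsProjectiveOnFinite (M : ModuleCat.{max u v} (MonoidAlgebra k G)) : Prop :=
  ∀ F : Subgroup G, Finite F → Projective (restrictToSubgroup k G M F)

lemma restrictToSubgroup_smul (M : ModuleCat.{max u v} (MonoidAlgebra k G)) (F : Subgroup G)
    (f : F) (c : k) (m : M) :
    (MonoidAlgebra.single f c : MonoidAlgebra k F) • (show restrictToSubgroup k G M F from m) =
      (MonoidAlgebra.single (F.subtype f) c : MonoidAlgebra k G) • m := by
  have : MonoidAlgebra.mapDomainRingHom k F.subtype (MonoidAlgebra.single f c) =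
      MonoidAlgebra.single (F.subtype f) c := MonoidAlgebra.mapDomain_single
  exact congrArg (fun r : MonoidAlgebra k G => r • m) this

lemma hasTraceOne_restrictToSubgroup_iff (M : ModuleCat.{max u v} (MonoidAlgebra k G))
    (F : Subgroup G) [Fintype F] :
    HasTraceOne (k := k) (MonoidHom.id F) (restrictToSubgroup k G M F) ↔
      HasTraceOne (k := k) F.subtype M := by
  have h₁ := restrictToSubgroup_smul M F
  constructor
  · rintro ⟨θ, hθ, hsum⟩
    refine ⟨θ, fun c m => ?_, fun m => ?_⟩
    · have := hθ c m
      exact (h₁ 1 c m) ▸ (h₁ 1 c (θ m)) ▸ this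
    · refine Eq.trans (Finset.sum_congr rfl fun h _ => ?_) (hsum m)
      exact ((h₁ h⁻¹ 1 _).trans (by rw [← h₁ h 1 m]; rfl)).symm
  · rintro ⟨θ, hθ, hsum⟩
    refine ⟨θ, fun c m => ?_, fun m => ?_⟩
    · have := hθ c m
      exact (congrArg θ (h₁ 1 c m)).trans (this.trans (h₁ 1 c (θ m)).symm)
    · refine Eq.trans (Finset.sum_congr rfl fun h _ => ?_) (hsum m)
      exact (h₁ h⁻¹ 1 _).trans (by erw [h₁ h 1 m]; rfl)

lemma isProjectiveOnFinite_iff (M : ModuleCat.{max u v} (MonoidAlgebra k G)) :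
    IsProjectiveOnFinite M ↔
      ∀ (F : Subgroup G) [Fintype F], HasTraceOne (k := k) F.subtype M := by
  constructor
  · intro h F _
    have := h F inferInstance
    have : Module.Projective (MonoidAlgebra k F) (restrictToSubgroup k G M F) :=
      (IsProjective.iff_projective _).2 this
    exact (hasTraceOne_restrictToSubgroup_iff M F).1
      (HasTraceOne.of_module_projective _ Function.injective_id)
  · intro h F _
    have := Fintype.ofFinite F
    have : Module.Projective (MonoidAlgebra k F) (restrictToSubgroup k G M F) :=
      ((hasTraceOne_restrictToSubgroup_iff M F).2 (h F)).module_projective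
    exact (IsProjective.iff_projective (restrictToSubgroup k G M F)).1 this

lemma isProjectiveOnFinite_of_projective (M : ModuleCat.{max u v} (MonoidAlgebra k G))
    [Projective M] : IsProjectiveOnFinite M :=
  have : Module.Projective (MonoidAlgebra k G) M := (IsProjective.iff_projective M).2 ‹_›
  (isProjectiveOnFinite_iff M).2 fun F _ =>
    HasTraceOne.of_module_projective _ F.subtype_injective

lemma isProjectiveOnFinite_of_injective (M : ModuleCat.{max u v} (MonoidAlgebra k G))
    [Injective M] : IsProjectiveOnFinite M :=
  (isProjectiveOnFinite_iff M).2 fun F _ => HasTraceOne.of_injective _ F.subtype_injective M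

lemma IsProjectiveOnFinite.pi {α : Type} {M : α → ModuleCat.{max u v} (MonoidAlgebra k G)}
    (hM : ∀ a, IsProjectiveOnFinite (M a)) :
    IsProjectiveOnFinite (ModuleCat.of (MonoidAlgebra k G) (∀ a, M a)) :=
  (isProjectiveOnFinite_iff _).2 fun F _ =>
    HasTraceOne.pi _ fun a => (isProjectiveOnFinite_iff _).1 (hM a) F

lemma IsProjectiveOnFinite.X₃ {S : ShortComplex (ModuleCat.{max u v} (MonoidAlgebra k G))}
    (hS : S.ShortExact) (h₁ : IsProjectiveOnFinite S.X₁) (h₂ : IsProjectiveOnFinite S.X₂) :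
    IsProjectiveOnFinite S.X₃ := fun F hF =>
  projective_X₃_of_finite (S := S.map (ModuleCat.restrictScalars.{max u v}
      (MonoidAlgebra.mapDomainRingHom k F.subtype)))
    (ModuleCat.shortComplex_shortExact _
      ((ShortComplex.ShortExact.moduleCat_exact_iff_function_exact S).1 hS.exact)
      hS.moduleCat_injective_f hS.moduleCat_surjective_g) (h₁ F hF) (h₂ F hF)

lemma isProjectiveOnFinite_of_hasProjectiveDimensionLT (n : ℕ)
    (M : ModuleCat.{max u v} (MonoidAlgebra k G)) (hM : HasProjectiveDimensionLT M (n + 1)) :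
    IsProjectiveOnFinite M := by
  induction n generalizing M with
  | zero =>
    have := projective_iff_hasProjectiveDimensionLT_one.2 hM
    exact isProjectiveOnFinite_of_projective M
  | succ n ih =>
    have hS : (ShortComplex.mk _ (Projective.π M) (kernel.condition _)).ShortExact :=
      { exact := ShortComplex.exact_kernel (Projective.π M) }
    exact IsProjectiveOnFinite.X₃ hS
      (ih _ ((hS.hasProjectiveDimensionLT_X₃_iff n inferInstance).1 hM))
      (isProjectiveOnFinite_of_projective _)

lemma isProjectiveOnFinite_iff_projectiveDimension_lt_top (hG : IsTypePhi k G)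
    (M : ModuleCat.{max u v} (MonoidAlgebra k G)) :
    IsProjectiveOnFinite M ↔ projectiveDimension M < ⊤ := by
  constructor
  · intro hM
    refine hG M fun F hF => ?_
    have := hM F hF
    exact lt_top_iff_ne_top.2 ((projectiveDimension_ne_top_iff _).2 ⟨0, inferInstance⟩)
  · intro hM
    obtain ⟨n, hn⟩ := (projectiveDimension_ne_top_iff _).1 hM.ne
    exact isProjectiveOnFinite_of_hasProjectiveDimensionLT n M hn

/-- Otherwise take `M n` of finite projective dimension exceeding `n`. Their product is projective
over finite subgroups, so it has finite projective dimension, which bounds that of every factor. -/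
lemma exists_bound_projectiveDimension (hG : IsTypePhi k G) :
    ∃ N : ℕ, ∀ M : ModuleCat.{max u v} (MonoidAlgebra k G), projectiveDimension M < ⊤ →
      projectiveDimension M ≤ N := by
  classical
  by_contra! h
  choose M hM hlt using h
  obtain ⟨n, hn⟩ := (projectiveDimension_ne_top_iff _).1
    ((isProjectiveOnFinite_iff_projectiveDimension_lt_top hG _).1 (IsProjectiveOnFinite.pi
      fun n => (isProjectiveOnFinite_iff_projectiveDimension_lt_top hG (M n)).2 (hM n))).ne
  have hr : Retract (M n) (ModuleCat.of (MonoidAlgebra k G) (∀ n, M n)) :=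
    { i := ModuleCat.ofHom (LinearMap.single (MonoidAlgebra k G) (fun n => M n) n)
      r := ModuleCat.ofHom (LinearMap.proj n)
      retract := by
        ext x
        exact Pi.single_eq_same (M := fun n => M n) n x }
  have := hr.hasProjectiveDimensionLT (n + 1)
  exact (hlt n).not_ge ((projectiveDimension_le_iff _ n).2 this)

lemma findim_eq_natCast (hG : IsTypePhi k G) : ∃ d : ℕ, findim k G = d := by
  obtain ⟨N, hN⟩ := exists_bound_projectiveDimension hG
  have hle : findim k G ≤ N := iSup₂_le hN
  -- The nonzero projective module `kG` shows that the supremum is not `⊥`.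
  let A := ModuleCat.of (MonoidAlgebra k G) (MonoidAlgebra k G)
  have hA : Projective A := (IsProjective.iff_projective (MonoidAlgebra k G)).1 inferInstance
  have hA₀ : projectiveDimension A = 0 := by
    refine (projectiveDimension_eq_zero_iff A).2 ⟨hA, fun h => ?_⟩
    exact not_subsingleton (MonoidAlgebra k G) (ModuleCat.isZero_iff_subsingleton.1 h)
  have hge : 0 ≤ findim k G := by
    rw [← hA₀]
    exact le_iSup₂_of_le A (by rw [hA₀]; exact WithBot.coe_lt_coe.2 (ENat.natCast_lt_top 0)) le_rfl
  generalize findim k G = e at hle hge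
  induction e with
  | bot => exact absurd hge (by simp)
  | coe e =>
    induction e with
    | top => exact absurd hle (by rw [not_le]; exact WithBot.coe_lt_coe.2 (ENat.natCast_lt_top N))
    | coe e => exact ⟨e, rfl⟩

lemma exists_completeResolution_of_isTypePhi (hG : IsTypePhi k G)
    (M : ModuleCat.{max u v} (MonoidAlgebra k G)) :
    ∃ C : CompleteResolution M, ((C.n : ℕ∞) : WithBot ℕ∞) = findim k G := by
  obtain ⟨d, hd⟩ := findim_eq_natCast hG
  have hdim : ∀ M : ModuleCat.{max u v} (MonoidAlgebra k G), IsProjectiveOnFinite M →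
      HasProjectiveDimensionLT M (d + 1) := fun M hM => by
    refine (projectiveDimension_le_iff M d).1 ?_
    rw [← hd]
    exact le_iSup₂_of_le M ((isProjectiveOnFinite_iff_projectiveDimension_lt_top hG M).1 hM) le_rfl
  obtain ⟨C, hC⟩ := exists_completeResolution d d
    (fun I hI => hdim I (isProjectiveOnFinite_of_injective I))
    (fun X hX => hasInjectiveDimensionLT_of_cosyzygies IsProjectiveOnFinite d hdim
      (fun S hS hI h₁ => IsProjectiveOnFinite.X₃ hS h₁ (isProjectiveOnFinite_of_injective _)) X
      (isProjectiveOnFinite_of_projective X)) M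
  exact ⟨C, by rw [hC, hd]; rfl⟩

end TypePhi

end

theorem theorem3 (p : ℕ) [Fact p.Prime] (k : Type u) (G : Type v) [Field k] [CharP k p] [Group G]
    (hG : IsTypePhi k G) :
    -- existence, with coincidence index at most the finitistic dimension
    (∀ M : ModuleCat.{max u v} (MonoidAlgebra k G),
      ∃ C : CompleteResolution M, ((C.n : ℕ∞) : WithBot ℕ∞) ≤ findim k G) ∧
    -- uniqueness up to chain homotopy equivalence (over the identity of the module)
    (∀ (M : ModuleCat.{max u v} (MonoidAlgebra k G)) (C D : CompleteResolution M),
      ∃ e : HomotopyEquiv C.Q D.Q,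
        C.IsInducedBy D (𝟙 M) e.hom ∧ D.IsInducedBy C (𝟙 M) e.inv) ∧
    -- a homomorphism induces a chain map; it can be chosen to agree with a given lift in all
    -- degrees from both coincidence indices on, and it is unique up to chain homotopy
    (∀ (M N : ModuleCat.{max u v} (MonoidAlgebra k G)) (f : M ⟶ N)
      (C : CompleteResolution M) (D : CompleteResolution N),
      (∃ F : C.Q ⟶ D.Q, C.IsInducedBy D f F) ∧
      (∀ φ : C.P.complex ⟶ D.P.complex, C.IsLift D f φ →
        ∃ F : C.Q ⟶ D.Q, Nonempty (Homotopy (F ≫ D.τ) (C.viaLeft D φ)) ∧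
          ∀ i : ℤ, (C.n : ℤ) ≤ i → (D.n : ℤ) ≤ i → (F ≫ D.τ).f i = (C.viaLeft D φ).f i) ∧
      (∀ F F' : C.Q ⟶ D.Q, C.IsInducedBy D f F → C.IsInducedBy D f F' →
        Nonempty (Homotopy F F'))) := by

  refine ⟨fun M => ?_, fun M C D => CompleteResolution.exists_homotopyEquiv C D,
    fun M N f C D => ⟨C.exists_isInducedBy D f, fun φ _ => C.exists_hom_of_lift D φ,
      fun F F' hF hF' => hF.nonempty_homotopy hF'⟩⟩
  obtain ⟨C, hC⟩ := exists_completeResolution_of_isTypePhi hG M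
  exact ⟨C, hC.le⟩
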